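/- Let $k$ be a field of characteristic zero and $\mathbb N=\{0,1,2,\dots\}$. An arithmetic progression is a subset of $\mathbb N$ of the form $j+\mathbb N l$ with $j,l\in\mathbb N$ (so singletons are allowed). Let $K=k(z)$ with the endomorphism $\sigma(h(z))=h(z+1)$, and let $\mathrm{Seq}_k$ be the ring of sequences $\mathbb N\to k$, two sequences being identified if they agree at all sufficiently large indices, with the shift $\sigma(f)=(f(1),f(2),\dots)$ and with $K$ embedded by $h\mapsto(h(0),h(1),\dots)$ (defined for all but finitely many indices). A ring $L$ with an endomorphism $\sigma$ is a $\sigma$-pseudo field if for some $l\ge1$ there are orthogonal idempotents $e_0,\dots,e_{l-1}\in L$ with $L=e_0L\oplus\dots\oplus e_{l-1}L$, $\sigma(e_0)=e_1,\dots,\sigma(e_{l-2})=e_{l-1}$, $\sigma(e_{l-1})=e_0$, and every $e_iL$ a field. For $A\in\mathrm{GL}_n(K)$, a Picard–Vessiot extension of $K$ for $\sigma(y)=Ay$ inside $\mathrm{Seq}_k$ is a $\sigma$-stable $K$-subalgebra $L\subseteq\mathrm{Seq}_k$ that is a $\sigma$-pseudo field, such that there is $Y\in\mathrm{GL}_n(L)$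 with $\sigma(Y)=AY$ for which $L$ is the total ring of fractions of $K[Y_{ij}]$, and such that $\{x\in L\mid\sigma(x)=x\}=\{c\in K\mid\sigma(c)=c\}$. **Theorem.** The following three statements are equivalent. 1. For every $n\in\mathbb N$ and every $A\in\mathrm{GL}_n(k(z))$, the rational map $\sigma\colon X\dashrightarrow X$, $\sigma(b,B)=(b+1,A(b)B)$, on $X=\mathbb A^1_k\times\mathrm{GL}_{n,k}$ has the following property: for every closed subvariety $Y\subseteq X$ and every $x\in X(k)$ whose orbit is defined (that is, each of $x,\sigma(x),\sigma^2(x),\dots$ lies in the domain of definition of $\sigma$), the set $\{i\in\mathbb N\mid\sigma^i(x)\in Y\}$ is a finite union of arithmetic progressions. 2. For every $n\in\mathbb N$, all $h_0,\dots,h_{n-1}\in k(z)$ and every sequence $f\colon\mathbb N\to k$ such that $f(i+n)+h_{n-1}(i)f(i+n-1)+\dots+h_0(i)f(i)=0$ for all sufficiently large $i$, the set $\{i\in\mathbb N\mid f(i)=0\}$ is a finite union of arithmetic progressions. 3. For every $n\in\mathbb N$ and every $A\in\mathrm{GL}_n(k(z))$ there exists a Picard–Vessiot extension of $k(z)$ for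 $\sigma(y)=Ay$ inside $\mathrm{Seq}_k$. -/

import Mathlib

open Filter

noncomputable section

namespace DifferenceEq

/-- `S ⊆ ℕ` is a finite union of arithmetic progressions `j + ℕ l` with `j, l ∈ ℕ`
(`l = 0` is allowed, so singletons are arithmetic progressions; the empty union is allowed). -/
def IsFiniteUnionAP (S : Set ℕ) : Prop :=
  ∃ T : Finset (ℕ × ℕ), S = {i | ∃ p ∈ T, ∃ m : ℕ, i = p.1 + m * p.2}

/-! ### The difference field `k(z)` -/

section RationalFunctions

variable {k : Type*} [Field k]

/-- The value `h(b)` of a rational function; it is meaningful where `h` is regular. -/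
def value (h : RatFunc k) (b : k) : k := RatFunc.eval (RingHom.id k) b h

/-- The rational function `h` has no pole at `b`. -/
def RegularAt (h : RatFunc k) (b : k) : Prop := h.denom.eval b ≠ 0

variable (k) in
/-- The endomorphism `h(z) ↦ h(z + 1)` of `k(z)`. -/
def shiftRatFunc : RatFunc k →+* RatFunc k :=
  RatFunc.mapRingHom (Polynomial.taylorAlgHom (1 : k)).toRingHom
    (nonZeroDivisors_le_comap_nonZeroDivisors_of_injective _ (Polynomial.taylor_injective 1))

end RationalFunctions

/-! ### The difference ring of sequences -/

/-- The ring of `k`-valued sequences, two sequences being identified if they agree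
at all sufficiently large indices. -/
def Seq (k : Type*) : Type _ := Germ (atTop : Filter ℕ) k

section Sequences

variable {k : Type*}

/-- The class of a sequence. -/
def Seq.mk (f : ℕ → k) : Seq k := Germ.ofFun f

theorem Seq.mk_eq_mk {f g : ℕ → k} : Seq.mk f = Seq.mk g ↔ ∀ᶠ i in atTop, f i = g i :=
  Germ.coe_eq

theorem Seq.exists_mk (x : Seq k) : ∃ f : ℕ → k, Seq.mk f = x := Quotient.exists_rep x

variable [Field k]

instance : CommRing (Seq k) := inferInstanceAs (CommRing (Germ (atTop : Filter ℕ) k))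

variable (k) in
/-- The left shift `(f(0), f(1), …) ↦ (f(1), f(2), …)` on classes of sequences. -/
def shiftSeq : Seq k →+* Seq k where
  toFun x := Germ.compTendsto (β := k) x (fun i : ℕ => i + 1) (tendsto_add_atTop_nat 1)
  map_one' := rfl
  map_zero' := rfl
  map_mul' x y := by
    obtain ⟨f, rfl⟩ := x.exists_mk
    obtain ⟨g, rfl⟩ := y.exists_mk
    rfl
  map_add' x y := by
    obtain ⟨f, rfl⟩ := x.exists_mk
    obtain ⟨g, rfl⟩ := y.exists_mk
    rfl

theorem shiftSeq_mk (f : ℕ → k) : shiftSeq k (Seq.mk f) = Seq.mk fun i => f (i + 1) := rfl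

variable [CharZero k]

theorem eventually_regularAt (h : RatFunc k) : ∀ᶠ i : ℕ in atTop, RegularAt h (i : k) := by
  have hfin : {i : ℕ | h.denom.eval (i : k) = 0}.Finite := by
    have hr : {x : k | h.denom.IsRoot x}.Finite :=
      Polynomial.finite_setOfPred_isRoot h.denom_ne_zero
    exact hr.preimage (Nat.cast_injective.injOn)
  have := hfin.eventually_cofinite_notMem
  rw [Nat.cofinite_eq_atTop] at this
  exact this

variable (k) in
/-- The embedding `h ↦ (h(0), h(1), h(2), …)` of `k(z)` into the ring of sequences;
it is well defined as `h` has only finitely many poles. -/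
def ratFuncToSeq : RatFunc k →+* Seq k where
  toFun h := Seq.mk fun i => value h (i : k)
  map_one' := Seq.mk_eq_mk.2 (Eventually.of_forall fun i => by simp [value])
  map_zero' := Seq.mk_eq_mk.2 (Eventually.of_forall fun i => by simp [value])
  map_mul' x y := by
    refine Seq.mk_eq_mk.2 ?_
    filter_upwards [eventually_regularAt x, eventually_regularAt y] with i hx hy
    exact RatFunc.eval_mul (f := RingHom.id k) (a := (i : k)) hx hy
  map_add' x y := by
    refine Seq.mk_eq_mk.2 ?_
    filter_upwards [eventually_regularAt x, eventually_regularAt y] with i hx hy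
    exact RatFunc.eval_add (f := RingHom.id k) (a := (i : k)) hx hy

/-- The ring of sequences as a `k(z)`-algebra. -/
instance : Algebra (RatFunc k) (Seq k) := (ratFuncToSeq k).toAlgebra

end Sequences

/-! ### Picard–Vessiot extensions -/

section PicardVessiot

/-- A difference ring `(L, σ)` is a `σ`-pseudo field: there are an integer `l = m + 1 ≥ 1` and
orthogonal idempotents `e₀, …, e_{l-1}` with `L = e₀L ⊕ ⋯ ⊕ e_{l-1}L`, which `σ` permutes
cyclically (addition in `Fin (m + 1)` is modulo `m + 1`), such that every ring `eᵢL`, whose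
identity element is `eᵢ`, is a field. -/
def IsPseudoField {L : Type*} [CommRing L] (σ : L →+* L) : Prop :=
  ∃ (m : ℕ) (e : Fin (m + 1) → L),
    CompleteOrthogonalIdempotents e ∧
    (∀ i, σ (e i) = e (i + 1)) ∧
    ∀ i, e i ≠ 0 ∧ ∀ x, e i * x ≠ 0 → ∃ y, (e i * x) * (e i * y) = e i

/-- The difference algebra `(L, σL)` over the difference field `(K, σK)` is a Picard–Vessiot
extension for `σ(y) = A y`. -/
structure IsPicardVessiotExtension {K L : Type*} [Field K] [CommRing L] [Algebra K L]
    (σK : K →+* K) (σL : L →+* L) {n : ℕ} (A : GL (Fin n) K) : Prop where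
  /-- `L` is a `K`-`σ`-algebra. -/
  commutes : ∀ a : K, σL (algebraMap K L a) = algebraMap K L (σK a)
  pseudoField : IsPseudoField σL
  /-- There is a fundamental solution matrix `Y` such that `L` is the total ring of fractions
  of `K[Y i j]`. -/
  generated : ∃ Y : GL (Fin n) L,
    (Y : Matrix (Fin n) (Fin n) L).map σL =
      (A : Matrix (Fin n) (Fin n) K).map (algebraMap K L) * (Y : Matrix (Fin n) (Fin n) L) ∧
    IsFractionRing
      (Algebra.adjoin K (Set.range fun p : Fin n × Fin n =>
        (Y : Matrix (Fin n) (Fin n) L) p.1 p.2)) L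
  /-- `L` has the same constants as `K`. -/
  constants : ∀ x : L, σL x = x ↔ ∃ c : K, σK c = c ∧ algebraMap K L c = x

/-- There is a Picard–Vessiot extension of `k(z)` for `σ(y) = A y` inside the ring of sequences,
that is, one which is a shift-stable `k(z)`-subalgebra of that ring. -/
def HasPVExtensionInSeq {k : Type*} [Field k] [CharZero k] {n : ℕ}
    (A : GL (Fin n) (RatFunc k)) : Prop :=
  ∃ (L : Subalgebra (RatFunc k) (Seq k)) (hL : ∀ x ∈ L, shiftSeq k x ∈ L),
    IsPicardVessiotExtension (shiftRatFunc k) ((shiftSeq k).restrict L L hL) A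

end PicardVessiot

/-! ### The rational self-map of `𝔸¹ × GLₙ` -/

section Dynamics

variable {k : Type*} [Field k] {n : ℕ}

variable (k n) in
/-- The `k`-points `(b, B)` of `X = 𝔸¹ × GLₙ`. -/
abbrev Pt : Type _ := k × GL (Fin n) k

/-- The coordinates of `(b, B)` in the affine space `𝔸^(1 + n²)` of which `X` is an open
subvariety: `none` is the coordinate `z`, and `some (i, j)` is the matrix coordinate `Z i j`. -/
def coords (x : Pt k n) : Option (Fin n × Fin n) → k
  | none => x.1
  | some p => (x.2 : Matrix (Fin n) (Fin n) k) p.1 p.2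

/-- The set of `k`-points of a closed subvariety of `X`, that is, the set of common zeros in
`X(k)` of a set of polynomials in `z` and the `Z i j`. (Allowing `1 / det Z` as well would give
the same sets, since denominators can be cleared.) -/
def IsClosedSubvariety (Y : Set (Pt k n)) : Prop :=
  ∃ S : Set (MvPolynomial (Option (Fin n × Fin n)) k),
    Y = {x | ∀ p ∈ S, MvPolynomial.eval (coords x) p = 0}

/-- The matrix `A(b)`. -/
def valueMatrix (A : GL (Fin n) (RatFunc k)) (b : k) : Matrix (Fin n) (Fin n) k :=
  (A : Matrix (Fin n) (Fin n) (RatFunc k)).map fun h => value h b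

/-- The domain of definition of the rational map `(b, B) ↦ (b + 1, A(b) B)` from `X` to `X`.
As `B` is invertible, the entries of `A(z) Z` are regular at `(b, B)` if and only if those of `A`
are regular at `b`, and then the value lies in `X` if and only if `det A(b) ≠ 0`. -/
def stepDomain (A : GL (Fin n) (RatFunc k)) : Set (Pt k n) :=
  {x | (∀ i j, RegularAt ((A : Matrix (Fin n) (Fin n) (RatFunc k)) i j) x.1) ∧
    (valueMatrix A x.1).det ≠ 0}

open Classical in
/-- The rational map `(b, B) ↦ (b + 1, A(b) B)`. Outside its domain of definition the
value is a placeholder. -/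
def step (A : GL (Fin n) (RatFunc k)) (x : Pt k n) : Pt k n :=
  if h : x ∈ stepDomain A then
    (x.1 + 1, Matrix.GeneralLinearGroup.mkOfDetNeZero (valueMatrix A x.1) h.2 * x.2)
  else x

/-- The orbit of `x` is defined: `x`, `σ(x)`, `σ²(x)`, … all lie in the domain of `σ`. -/
def OrbitDefined (A : GL (Fin n) (RatFunc k)) (x : Pt k n) : Prop :=
  ∀ i : ℕ, (step A)^[i] x ∈ stepDomain A

end Dynamics

/-- The sequence `f` solves `σⁿ(y) + h_{n-1} σⁿ⁻¹(y) + ⋯ + h₀ y = 0`: the recurrence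
`f(i+n) + h_{n-1}(i) f(i+n-1) + ⋯ + h₀(i) f(i) = 0` holds for all sufficiently large `i`. -/
def IsSolution {k : Type*} [Field k] {n : ℕ} (h : Fin n → RatFunc k) (f : ℕ → k) : Prop :=
  ∀ᶠ i : ℕ in atTop, f (i + n) + ∑ j : Fin n, value (h j) (i : k) * f (i + j) = 0

end DifferenceEq

end

/-! The three statements are equivalent to one property: the zero set of every sequence that
satisfies a linear recurrence over `k(z)` is eventually periodic.

The solutions of recurrences are the elements of finite-dimensional `σ`-stable subspaces, so they
form a `k(z)`-subalgebra of `Seq k`. Hence every polynomial in the coordinates of an orbit of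
`(b, B) ↦ (b + 1, A(b) B)` is such a sequence. Conversely, a solution of a recurrence is an entry of
a solution of an invertible system (`σ` is bijective on `k(z)` and on `Seq k`), hence the value of
a linear form along an orbit.

In `Seq k`, `x` divides `y` if and only if the zeros of `x` are eventually zeros of `y`, so
periodic zeros mean that `x` and `σˡ(x)` divide each other. In a pseudo field with `l` factors
this always holds, and a Picard–Vessiot extension contains every solution of its system because it
contains the constants. Conversely, let `R` be generated by the entries of a fundamental matrix
and assume that its elements have periodic zeros. As `R` is noetherian, there is a residue class
whose annihilator in `R` is maximal; on it every element of `R` is zero or invertible, and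
shifting it makes its modulus a common period of the zeros. For the smallest common period `l`,
the residue classes modulo `l` are the factors, and the total ring of fractions of `R` is the
Picard–Vessiot extension. -/

noncomputable section

namespace DifferenceEq

theorem isSemilinearSet_progression (j l : ℕ) : IsSemilinearSet {i | ∃ m : ℕ, i = j + m * l} := by
  convert ((IsLinearSet.closure_finset {l}).vadd j).isSemilinearSet using 1
  ext i
  simp [Set.mem_vadd_set, AddSubmonoid.mem_closure_singleton, eq_comm]

theorem IsFiniteUnionAP.isSemilinearSet {S : Set ℕ} (hS : IsFiniteUnionAP S) :
    IsSemilinearSet S := by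
  obtain ⟨T, rfl⟩ := hS
  convert IsSemilinearSet.biUnion_finset (s := T) fun p _ => isSemilinearSet_progression p.1 p.2
  ext
  simp

theorem isFiniteUnionAP_iff_isSemilinearSet {S : Set ℕ} :
    IsFiniteUnionAP S ↔ IsSemilinearSet S := by
  classical
  refine ⟨IsFiniteUnionAP.isSemilinearSet, fun hS => ?_⟩
  obtain ⟨N, l, hl, hper⟩ := Nat.isSemilinearSet_iff_ultimately_periodic.1 hS
  have hmul (i m : ℕ) (hi : N ≤ i) : i ∈ S ↔ i + m * l ∈ S := by
    induction m with
    | zero => simp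
    | succ m ih => rw [ih, hper _ (by lia), Nat.succ_mul, add_assoc]
  refine ⟨{i ∈ Finset.range (N + l) | i ∈ S}.image fun i => (i, if i < N then 0 else l), ?_⟩
  ext i
  simp only [Finset.exists_mem_image, Finset.mem_filter, Finset.mem_range, Set.mem_ofPred_eq]
  constructor
  · intro hi
    obtain h | h := lt_or_ge i N
    · exact ⟨i, ⟨by lia, hi⟩, 0, by simp⟩
    · have hdiv : N + (i - N) % l + (i - N) / l * l = i := by
        rw [add_assoc, Nat.mod_add_div', Nat.add_sub_cancel' h]
      have hlt := Nat.mod_lt (i - N) hl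
      exact ⟨N + (i - N) % l, ⟨by lia, by rwa [hmul _ ((i - N) / l) (by lia), hdiv]⟩,
        (i - N) / l, by simp [hdiv]⟩
  · rintro ⟨j, ⟨-, hj⟩, m, rfl⟩
    split_ifs with h
    · simpa using hj
    · exact (hmul j m (by lia)).1 hj

theorem isFiniteUnionAP_iff {S : Set ℕ} :
    IsFiniteUnionAP S ↔ ∃ l > 0, ∀ᶠ i in atTop, (i ∈ S ↔ i + l ∈ S) := by
  rw [isFiniteUnionAP_iff_isSemilinearSet, Nat.isSemilinearSet_iff_ultimately_periodic]
  simp only [eventually_atTop]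
  exact ⟨fun ⟨N, l, hl, h⟩ => ⟨l, hl, N, h⟩, fun ⟨l, hl, N, h⟩ => ⟨N, l, hl, h⟩⟩

theorem isFiniteUnionAP_setOf_forall_mem {ι : Type*} (T : Finset ι) {S : ι → Set ℕ}
    (hS : ∀ i ∈ T, IsFiniteUnionAP (S i)) : IsFiniteUnionAP {m | ∀ i ∈ T, m ∈ S i} := by
  simp only [isFiniteUnionAP_iff_isSemilinearSet] at hS ⊢
  convert IsSemilinearSet.biInter_finset hS using 1
  ext
  simp

theorem isFiniteUnionAP_of_add {S : Set ℕ} (N : ℕ) (hS : IsFiniteUnionAP {i | i + N ∈ S}) :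
    IsFiniteUnionAP S := by
  obtain ⟨l, hl, h⟩ := isFiniteUnionAP_iff.1 hS
  refine isFiniteUnionAP_iff.2 ⟨l, hl, ?_⟩
  rw [← map_add_atTop_eq_nat N, eventually_map]
  simpa only [Set.mem_ofPred_eq, add_right_comm] using h

/-! ### Subalgebras of a product of rings whose total ring of fractions is a product of fields -/

section TotalFractions

variable {ι K A : Type*} [CommRing K] [CommRing A] [Algebra K A]

section Idempotents

variable [Fintype ι] {e : ι → A}

theorem dvd_of_forall_dvd_mul (he : ∑ c, e c = 1) {x y : A} (h : ∀ c, x ∣ y * e c) : x ∣ y := by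
  rw [← mul_one y, ← he, Finset.mul_sum]
  exact Finset.dvd_sum fun c _ => h c

theorem isUnit_of_forall_dvd (he : ∑ c, e c = 1) {x : A} (h : ∀ c, x ∣ e c) : IsUnit x :=
  isUnit_of_dvd_one <| dvd_of_forall_dvd_mul he fun c => by simpa using h c

theorem isUnit_mul_add_one_sub (he : CompleteOrthogonalIdempotents e) {x : A} {c : ι}
    (hx : x ∣ e c) : IsUnit (x * e c + (1 - e c)) := by
  refine isUnit_of_forall_dvd he.complete fun d => ?_
  obtain rfl | hdc := eq_or_ne d c
  · obtain ⟨y, hy⟩ := hx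
    exact ⟨e d * y, by linear_combination e d ^ 2 * hy + (y - 1 - e d) * (he.idem d).eq⟩
  · exact ⟨e d, by linear_combination (1 - x) * he.ortho hdc⟩

end Idempotents

/-- The subalgebra of fractions `a / b` of elements of `R`, where `b` is invertible in the
ambient ring. -/
def fractions (R : Subalgebra K A) : Subalgebra K A :=
  R.saturation (R.toSubmonoid ⊓ IsUnit.submonoid A) inf_le_left

theorem mem_fractions {R : Subalgebra K A} {x : A} :
    x ∈ fractions R ↔ ∃ b ∈ R, IsUnit b ∧ b * x ∈ R := by
  simp [fractions, and_assoc, IsUnit.mem_submonoid_iff]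

theorem le_fractions (R : Subalgebra K A) : R ≤ fractions R := Subalgebra.le_saturation

theorem map_mem_fractions {R : Subalgebra K A} {σ : A →+* A} (hR : ∀ x ∈ R, σ x ∈ R) :
    ∀ x ∈ fractions R, σ x ∈ fractions R := by
  simp only [mem_fractions]
  rintro x ⟨b, hb, hb', hbx⟩
  exact ⟨σ b, hR b hb, hb'.map σ, by simpa using hR _ hbx⟩

theorem mem_fractions_of_mul_eq_one {R : Subalgebra K A} {x y : A} (hx : x ∈ fractions R)
    (hxy : x * y = 1) : y ∈ fractions R := by
  obtain ⟨b, hb, hb', hbx⟩ := mem_fractions.1 hx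
  exact mem_fractions.2 ⟨b * x, hbx, hb'.mul (.of_mul_eq_one _ hxy), by simpa [mul_assoc, hxy]⟩

theorem isUnit_coe_fractions {R : Subalgebra K A} {x : fractions R} :
    IsUnit (x : A) ↔ IsUnit x := by
  refine ⟨fun hx => ?_, fun hx => hx.map (fractions R).val⟩
  obtain ⟨y, hy⟩ := hx.exists_right_inv
  exact .of_mul_eq_one ⟨y, mem_fractions_of_mul_eq_one x.2 hy⟩ (Subtype.ext hy)

/-- The subalgebra `R` of the product `A = ∏ A e_c` is separated along the idempotents `e`: every
element of `R` is zero or invertible in each factor (`x` is invertible in `A e_c`, whose identity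
is `e_c`, if and only if `x ∣ e_c`), and no two factors have the same elements of `R` vanishing
on them. -/
structure IsSeparatedAlong [Fintype ι] (e : ι → A) (R : Subalgebra K A) : Prop
    extends CompleteOrthogonalIdempotents e where
  ne_zero : ∀ c, e c ≠ 0
  eq_zero_or_dvd : ∀ x ∈ R, ∀ c, x * e c = 0 ∨ x ∣ e c
  exists_separating : ∀ c d, c ≠ d → ∃ x ∈ R, x * e c = 0 ∧ x * e d ≠ 0

namespace IsSeparatedAlong

variable [Fintype ι] {e : ι → A} {R : Subalgebra K A} (h : IsSeparatedAlong e R)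
include h

theorem exists_mem_dvd (c : ι) : ∃ s ∈ R, s ∣ e c ∧ ∀ d ≠ c, s * e d = 0 := by
  classical
  have hsep (d : ι) (hd : d ≠ c) : ∃ x ∈ R, x * e d = 0 ∧ x ∣ e c := by
    obtain ⟨x, hx, hxd, hxc⟩ := h.exists_separating d c hd
    exact ⟨x, hx, hxd, (h.eq_zero_or_dvd x hx c).resolve_left hxc⟩
  choose! x hxR hxd hxc using hsep
  refine ⟨∏ d ∈ Finset.univ.erase c, x d,
    prod_mem fun d hd => hxR d (Finset.ne_of_mem_erase hd), ?_, fun d hd => ?_⟩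
  · refine Finset.prod_induction x (· ∣ e c) (fun a b ha hb => ?_) (one_dvd _)
      fun d hd => hxc d (Finset.ne_of_mem_erase hd)
    rw [← (h.idem c).eq]
    exact mul_dvd_mul ha hb
  · exact zero_dvd_iff.1 <| hxd d hd ▸
      mul_dvd_mul_right (Finset.dvd_prod_of_mem x (Finset.mem_erase.2 ⟨hd, Finset.mem_univ d⟩)) _

theorem idempotent_mem_fractions (c : ι) : e c ∈ fractions R := by
  choose s hsR hse hs using h.exists_mem_dvd
  have hsum (d : ι) : (∑ d', s d') * e d = s d := by
    calc (∑ d', s d') * e d = s d * e d := by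
          rw [Finset.sum_mul]
          exact Finset.sum_eq_single d (fun d' _ hd' => hs d' d hd'.symm) (by simp)
      _ = s d * ∑ d', e d' := by
          rw [Finset.mul_sum]
          exact (Finset.sum_eq_single d (fun d' _ hd' => hs d d' hd') (by simp)).symm
      _ = s d := by rw [h.complete, mul_one]
  refine mem_fractions.2 ⟨∑ d, s d, sum_mem fun d _ => hsR d,
    isUnit_of_forall_dvd h.complete fun d => ?_, (hsum c).symm ▸ hsR c⟩
  obtain ⟨t, ht⟩ := hse d
  exact ⟨e d * t, by rw [← mul_assoc, hsum, ht]⟩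

theorem exists_mul_eq_idempotent {c : ι} {x : A} (hx : x ∈ fractions R) (hxc : e c * x ≠ 0) :
    ∃ y ∈ fractions R, e c * x * (e c * y) = e c := by
  obtain ⟨b, -, hb, hbx⟩ := mem_fractions.1 hx
  have hdvd : x ∣ e c := by
    refine (dvd_mul_left x b).trans ((h.eq_zero_or_dvd _ hbx c).resolve_left fun h0 => hxc ?_)
    exact hb.mul_right_eq_zero.1 (by linear_combination h0)
  obtain ⟨y, hy⟩ := (isUnit_mul_add_one_sub h.toCompleteOrthogonalIdempotents hdvd).exists_right_inv
  have hec := h.idempotent_mem_fractions c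
  refine ⟨y, mem_fractions_of_mul_eq_one
    (add_mem (mul_mem hx hec) (sub_mem (one_mem _) hec)) hy, ?_⟩
  linear_combination e c * hy + y * (h.idem c).eq

theorem isUnit_of_forall_mul_eq_zero {x : A} (hx : x ∈ R)
    (hx0 : ∀ y ∈ R, x * y = 0 → y = 0) : IsUnit x := by
  refine isUnit_of_forall_dvd h.complete fun c =>
    (h.eq_zero_or_dvd x hx c).resolve_left fun hxc => ?_
  obtain ⟨s, hsR, hsc, hs⟩ := h.exists_mem_dvd c
  have hs0 : s = 0 := hx0 s hsR <| zero_dvd_iff.1 <| by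
    refine dvd_of_forall_dvd_mul h.complete fun d => ?_
    obtain rfl | hd := eq_or_ne d c
    · exact ⟨0, by linear_combination s * hxc⟩
    · exact ⟨0, by linear_combination x * hs d hd⟩
  exact h.ne_zero c (zero_dvd_iff.1 (hs0 ▸ hsc))

theorem isFractionRing_fractions {T : Subalgebra K (fractions R)}
    (hT : T.map (fractions R).val = R) : IsFractionRing T (fractions R) := by
  have coe_mem_iff (x : fractions R) : (x : A) ∈ R ↔ x ∈ T := by
    rw [← SetLike.ext_iff.1 hT (x : A), Subalgebra.mem_map]
    exact ⟨fun ⟨y, hy, hyx⟩ => Subtype.ext hyx ▸ hy, fun hx => ⟨x, hx, rfl⟩⟩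
  refine (isLocalization_iff _ _).2 ⟨fun x => isUnit_coe_fractions.1 ?_, fun x => ?_,
    fun {x y} hxy => ⟨1, by rw [Subtype.val_injective hxy]⟩⟩
  · refine h.isUnit_of_forall_mul_eq_zero ((coe_mem_iff _).2 x.1.2) fun y hy hxy => ?_
    have hyT : ⟨y, le_fractions R hy⟩ ∈ T := (coe_mem_iff _).1 hy
    have hy0 : (⟨_, hyT⟩ : T) = 0 :=
      (mul_left_mem_nonZeroDivisors_eq_zero_iff x.2).1 (Subtype.ext (Subtype.ext hxy))
    exact congrArg (fun z : T => ((z : fractions R) : A)) hy0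
  · obtain ⟨b, hb, hb', hbx⟩ := mem_fractions.1 x.2
    refine ⟨(⟨⟨b * x, le_fractions R hbx⟩, (coe_mem_iff _).1 hbx⟩,
      ⟨⟨⟨b, le_fractions R hb⟩, (coe_mem_iff _).1 hb⟩, ?_⟩), Subtype.ext (mul_comm _ _)⟩
    exact mem_nonZeroDivisors_of_injective (f := algebraMap T (fractions R))
      Subtype.val_injective (isUnit_coe_fractions.1 hb').mem_nonZeroDivisors

end IsSeparatedAlong

end TotalFractions

/-! ### Linear difference systems -/

section DifferenceAlgebra

section CommRing

variable {K E : Type*} [CommRing K] [CommRing E] [Algebra K E] {σK : K →+* K} {σ : E →+* E}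

theorem map_smul_of_map_algebraMap (hσ : ∀ a, σ (algebraMap K E a) = algebraMap K E (σK a))
    (a : K) (x : E) : σ (a • x) = σK a • σ x := by
  rw [Algebra.smul_def, map_mul, hσ, Algebra.smul_def]

theorem map_mem_span (hσ : ∀ a, σ (algebraMap K E a) = algebraMap K E (σK a)) {s : Set E}
    (hs : ∀ x ∈ s, σ x ∈ Submodule.span K s) :
    ∀ x ∈ Submodule.span K s, σ x ∈ Submodule.span K s := by
  intro x hx
  induction hx using Submodule.span_induction with
  | mem x hx => exact hs x hx
  | zero => simp
  | add x y _ _ hx hy => exact map_add σ x y ▸ add_mem hx hy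
  | smul a x _ hx => exact map_smul_of_map_algebraMap hσ a x ▸ Submodule.smul_mem _ _ hx

theorem map_mem_adjoin (hσ : ∀ a, σ (algebraMap K E a) = algebraMap K E (σK a)) {s : Set E}
    (hs : ∀ x ∈ s, σ x ∈ Algebra.adjoin K s) :
    ∀ x ∈ Algebra.adjoin K s, σ x ∈ Algebra.adjoin K s := by
  intro x hx
  induction hx using Algebra.adjoin_induction with
  | mem x hx => exact hs x hx
  | algebraMap a => exact hσ a ▸ Subalgebra.algebraMap_mem _ _
  | add x y _ _ hx hy => exact map_add σ x y ▸ add_mem hx hy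
  | mul x y _ _ hx hy => exact map_mul σ x y ▸ mul_mem hx hy

/-- The subalgebra of the elements of a difference algebra `(E, σ)` over `(K, σK)` that lie in a
finitely generated `σ`-stable `K`-submodule. Over a field these are the solutions of linear
recurrences, see `mem_recurrent_iff`. -/
def recurrent (hσ : ∀ a, σ (algebraMap K E a) = algebraMap K E (σK a)) : Subalgebra K E where
  carrier := {x | ∃ V : Submodule K E, V.FG ∧ Set.MapsTo σ V V ∧ x ∈ V}
  add_mem' := by
    rintro x y ⟨V, hV, hσV, hx⟩ ⟨W, hW, hσW, hy⟩
    refine ⟨V ⊔ W, hV.sup hW, fun v hv => ?_, Submodule.add_mem_sup hx hy⟩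
    obtain ⟨a, ha, b, hb, rfl⟩ := Submodule.mem_sup.1 hv
    exact map_add σ a b ▸ Submodule.add_mem_sup (hσV ha) (hσW hb)
  mul_mem' := by
    rintro x y ⟨V, hV, hσV, hx⟩ ⟨W, hW, hσW, hy⟩
    refine ⟨V * W, hV.mul hW, fun v hv => ?_, Submodule.mul_mem_mul hx hy⟩
    induction hv using Submodule.mul_induction_on' with
    | mem_mul_mem a ha b hb => exact map_mul σ a b ▸ Submodule.mul_mem_mul (hσV ha) (hσW hb)
    | add a _ b _ ha hb => exact map_add σ a b ▸ add_mem ha hb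
  algebraMap_mem' a := by
    refine ⟨Submodule.span K {1}, Submodule.fg_span_singleton 1, map_mem_span hσ ?_, ?_⟩
    · simp [Submodule.mem_span_singleton_self]
    · exact Algebra.algebraMap_eq_smul_one (A := E) a ▸
        Submodule.smul_mem _ _ (Submodule.mem_span_singleton_self _)

variable (hσ : ∀ a, σ (algebraMap K E a) = algebraMap K E (σK a))

theorem mem_recurrent_of_map_mem_span {ι : Type*} [Finite ι] {v : ι → E}
    (hv : ∀ i, σ (v i) ∈ Submodule.span K (Set.range v)) (i : ι) : v i ∈ recurrent hσ :=
  ⟨Submodule.span K (Set.range v), Submodule.fg_span (Set.finite_range v),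
    map_mem_span hσ (Set.forall_mem_range.2 hv), Submodule.subset_span ⟨i, rfl⟩⟩

theorem mem_recurrent_of_map_eq_mul {ι κ : Type*} [Fintype ι] {A : Matrix ι ι K}
    {Y : Matrix ι κ E} (hY : Y.map σ = A.map (algebraMap K E) * Y) (i : ι) (j : κ) :
    Y i j ∈ recurrent hσ := by
  refine mem_recurrent_of_map_mem_span hσ (v := fun i => Y i j) (fun i => ?_) i
  rw [← Matrix.map_apply (f := σ), hY, Matrix.mul_apply]
  refine sum_mem fun s _ => ?_
  rw [Matrix.map_apply, ← Algebra.smul_def]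
  exact Submodule.smul_mem _ _ (Submodule.subset_span ⟨s, rfl⟩)

theorem exists_recurrence [IsNoetherianRing K] {x : E} (hx : x ∈ recurrent hσ) :
    ∃ (n : ℕ) (h : Fin n → K), σ^[n] x + ∑ j, h j • σ^[j] x = 0 := by
  obtain ⟨V, hV, hσV, hx⟩ := hx
  have : IsNoetherian K V := isNoetherian_of_fg_of_noetherian V hV
  let u (j : ℕ) : V := ⟨σ^[j] x, hσV.iterate j hx⟩
  let W : ℕ →o Submodule K V :=
    ⟨fun n => Submodule.span K (Set.range fun j : Fin n => u j), fun a b hab =>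
      Submodule.span_mono <| Set.range_subset_iff.2 fun j => ⟨Fin.castLE hab j, rfl⟩⟩
  obtain ⟨n, hn⟩ := monotone_stabilizes_iff_noetherian.2 ‹_› W
  have hu : u n ∈ W n := hn (n + 1) n.le_succ ▸ Submodule.subset_span ⟨Fin.last n, rfl⟩
  obtain ⟨c, hc⟩ := (Submodule.mem_span_range_iff_exists_fun _).1 hu
  refine ⟨n, -c, ?_⟩
  have hc' : ∑ j, c j • σ^[j] x = σ^[n] x := by simpa [u] using congrArg Subtype.val hc
  simp [hc']

theorem mem_recurrent_of_recurrence {x : E} {n : ℕ} {h : Fin n → K}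
    (hx : σ^[n] x + ∑ j, h j • σ^[j] x = 0) : x ∈ recurrent hσ := by
  have hmem (i : ℕ) (hi : i ≤ n) :
      σ^[i] x ∈ Submodule.span K (Set.range fun j : Fin n => σ^[j] x) := by
    obtain hi | rfl := hi.lt_or_eq
    · exact Submodule.subset_span ⟨⟨i, hi⟩, rfl⟩
    · rw [eq_neg_of_add_eq_zero_left hx]
      exact neg_mem <| sum_mem fun j _ => Submodule.smul_mem _ _ (Submodule.subset_span ⟨j, rfl⟩)
  refine ⟨_, Submodule.fg_span (Set.finite_range _),
    map_mem_span hσ (Set.forall_mem_range.2 fun j => ?_), hmem 0 n.zero_le⟩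
  rw [← Function.iterate_succ_apply' σ]
  exact hmem _ j.2

theorem mem_recurrent_iff [IsNoetherianRing K] {x : E} :
    x ∈ recurrent hσ ↔ ∃ (n : ℕ) (h : Fin n → K), σ^[n] x + ∑ j, h j • σ^[j] x = 0 :=
  ⟨exists_recurrence hσ, fun ⟨_, _, h⟩ => mem_recurrent_of_recurrence hσ h⟩

theorem mem_of_map_eq_mulVec {ι : Type*} [Fintype ι] [DecidableEq ι] {L : Subring E}
    {B Z : GL ι E} (hZ : (Z : Matrix ι ι E).map σ = B * Z) (hZL : ∀ i j, Z i j ∈ L)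
    (hL : ∀ x, σ x = x → x ∈ L) {v : ι → E} (hv : σ ∘ v = (B : Matrix ι ι E).mulVec v) (i : ι) :
    v i ∈ L := by
  have hZ' : Matrix.GeneralLinearGroup.map σ Z = B * Z := Units.ext hZ
  have hinv : ((Z⁻¹ : GL ι E) : Matrix ι ι E).map σ = ((B * Z)⁻¹ : GL ι E) := by
    rw [← hZ', ← map_inv]
    rfl
  have hconst : σ ∘ ((Z⁻¹ : GL ι E) : Matrix ι ι E).mulVec v =
      ((Z⁻¹ : GL ι E) : Matrix ι ι E).mulVec v := by
    ext i
    rw [Function.comp_apply, RingHom.map_mulVec, hinv, hv, Matrix.mulVec_mulVec, ← Units.val_mul,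
      mul_inv_rev, inv_mul_cancel_right]
  have hvZ : v = (Z : Matrix ι ι E).mulVec (((Z⁻¹ : GL ι E) : Matrix ι ι E).mulVec v) := by
    rw [Matrix.mulVec_mulVec, ← Units.val_mul, mul_inv_cancel, Units.val_one, Matrix.one_mulVec]
  rw [hvZ]
  exact sum_mem fun j _ => mul_mem (hZL i j) (hL _ (congrFun hconst j))

end CommRing

section Field

variable {K E : Type*} [Field K] [CommRing E] [Algebra K E] {σK : K →+* K} {σ : E →+* E}

theorem exists_system_of_linearIndependent {ι : Type*} [Fintype ι] [DecidableEq ι]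
    (hσ : ∀ a, σ (algebraMap K E a) = algebraMap K E (σK a))
    (hσK : Function.Surjective σK) (hinj : Function.Injective σ)
    {v : ι → E} (hv : LinearIndependent K v)
    (hσv : ∀ i, σ (v i) ∈ Submodule.span K (Set.range v)) :
    ∃ A : GL ι K, ∀ i, σ (v i) = ∑ j, A i j • v j := by
  choose A hA using fun i => (Submodule.mem_span_range_iff_exists_fun K).1 (hσv i)
  have hσv : LinearIndependent K (σ ∘ v) :=
    hv.map_of_surjective_injectiveₛ σK σ.toAddMonoidHom hσK hinj
      (map_smul_of_map_algebraMap hσ)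
  have hcomp : σ ∘ v = Fintype.linearCombination K v ∘ A := by
    ext i
    simp [Fintype.linearCombination_apply, hA]
  have hunit : IsUnit (Matrix.of A) := Matrix.linearIndependent_rows_iff_isUnit.1 <|
    LinearIndependent.of_comp (Fintype.linearCombination K v) (hcomp ▸ hσv)
  exact ⟨hunit.unit, fun i => (hA i).symm⟩

theorem exists_system (hσ : ∀ a, σ (algebraMap K E a) = algebraMap K E (σK a))
    (hσK : Function.Surjective σK) (hinj : Function.Injective σ) {x : E} (hx : x ∈ recurrent hσ) :
    ∃ (n : ℕ) (A : GL (Fin n) K) (v : Fin n → E),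
      (∀ i, σ (v i) = ∑ j, A i j • v j) ∧ ∃ i, v i = x := by
  obtain rfl | hx0 := eq_or_ne x 0
  · exact ⟨1, 1, 0, by simp, 0, rfl⟩
  obtain ⟨V, hV, hσV, hx⟩ := hx
  obtain ⟨b, hbV, hxb, hVb, hb⟩ := exists_linearIndepOn_id_extension (K := K) (t := (V : Set E))
    (LinearIndepOn.singleton (v := id) hx0) (Set.singleton_subset_iff.2 hx)
  replace hb : LinearIndependent K ((↑) : b → E) := hb
  have hspan : Submodule.span K (Set.range ((↑) : b → E)) = V := by
    rw [Subtype.range_coe]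
    exact le_antisymm (Submodule.span_le.2 hbV) hVb
  have : Finite b := by
    have := Module.Finite.iff_fg.2 (hspan ▸ hV)
    exact Module.Finite.finite_basis (Module.Basis.span hb)
  let eb := Finite.equivFin b
  obtain ⟨A, hA⟩ := exists_system_of_linearIndependent hσ hσK hinj (v := Subtype.val ∘ eb.symm)
    (hb.comp _ eb.symm.injective) fun i => by
      rw [eb.symm.surjective.range_comp, hspan]
      exact hσV (hbV (eb.symm i).2)
  exact ⟨_, A, _, hA, eb ⟨x, hxb rfl⟩, congrArg Subtype.val (eb.symm_apply_apply _)⟩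

end Field

end DifferenceAlgebra

/-! ### Picard–Vessiot rings -/

section PicardVessiot

/-- The `K`-algebra generated by the entries of a matrix over `E`; for a fundamental matrix of a
linear difference system this is the candidate Picard–Vessiot ring, of which the Picard–Vessiot
extension is the total ring of fractions. -/
def adjoinEntries {ι κ E : Type*} (K : Type*) [CommRing K] [CommRing E] [Algebra K E]
    (Y : Matrix ι κ E) : Subalgebra K E :=
  Algebra.adjoin K (Set.range fun p : ι × κ => Y p.1 p.2)

section CommRing

variable {ι κ K E : Type*} [CommRing K] [CommRing E] [Algebra K E] {σK : K →+* K} {σ : E →+* E}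
  {A : Matrix ι ι K} {Y : Matrix ι κ E}

theorem entry_mem_adjoinEntries (i : ι) (j : κ) : Y i j ∈ adjoinEntries K Y :=
  Algebra.subset_adjoin ⟨(i, j), rfl⟩

variable (hσ : ∀ a, σ (algebraMap K E a) = algebraMap K E (σK a))
include hσ

theorem map_mem_adjoinEntries [Fintype ι] (hY : Y.map σ = A.map (algebraMap K E) * Y) :
    ∀ x ∈ adjoinEntries K Y, σ x ∈ adjoinEntries K Y := by
  refine map_mem_adjoin hσ (Set.forall_mem_range.2 fun p => ?_)
  rw [← Matrix.map_apply (f := σ), hY, Matrix.mul_apply]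
  exact sum_mem fun s _ => mul_mem (Subalgebra.algebraMap_mem _ _) (entry_mem_adjoinEntries s p.2)

theorem adjoinEntries_le_recurrent [Fintype ι] (hY : Y.map σ = A.map (algebraMap K E) * Y) :
    adjoinEntries K Y ≤ recurrent hσ :=
  Algebra.adjoin_le <| Set.range_subset_iff.2 fun p => mem_recurrent_of_map_eq_mul hσ hY p.1 p.2

end CommRing

instance {ι κ K E : Type*} [Finite ι] [Finite κ] [CommRing K] [IsNoetherianRing K] [CommRing E]
    [Algebra K E] (Y : Matrix ι κ E) : IsNoetherianRing (adjoinEntries K Y) := by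
  have : Algebra.FiniteType K (adjoinEntries K Y) := Algebra.FiniteType.adjoin_of_finite
    (Set.finite_range fun p : ι × κ => Y p.1 p.2)
  exact Algebra.FiniteType.isNoetherianRing K (adjoinEntries K Y)

theorem IsSeparatedAlong.isPseudoField_fractions {K E : Type*} [CommRing K] [CommRing E]
    [Algebra K E] {σ : E →+* E} {R : Subalgebra K E} (hσR : ∀ x ∈ R, σ x ∈ R)
    {m : ℕ} {e : Fin (m + 1) → E} (h : IsSeparatedAlong e R) (hσe : ∀ c, σ (e c) = e (c + 1)) :
    IsPseudoField (σ.restrict (fractions R) (fractions R) (map_mem_fractions hσR)) := by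
  refine ⟨m, fun c => ⟨e c, h.idempotent_mem_fractions c⟩, ?_, fun c => Subtype.ext (hσe c),
    fun c => ⟨fun h0 => h.ne_zero c (congrArg Subtype.val h0), fun x hx => ?_⟩⟩
  · exact (CompleteOrthogonalIdempotents.map_injective_iff (fractions R).val.toRingHom
      Subtype.val_injective).1 h.toCompleteOrthogonalIdempotents
  · obtain ⟨y, hy, hxy⟩ := h.exists_mul_eq_idempotent x.2 fun h0 => hx (Subtype.ext h0)
    exact ⟨⟨y, hy⟩, Subtype.ext hxy⟩

theorem IsSeparatedAlong.isPicardVessiotExtension_fractions {K E : Type*} [Field K] [CommRing E]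
    [Algebra K E] {σK : K →+* K} {σ : E →+* E}
    (hσ : ∀ a, σ (algebraMap K E a) = algebraMap K E (σK a))
    (hconst : ∀ x, σ x = x → ∃ c, σK c = c ∧ algebraMap K E c = x)
    {n : ℕ} {A : GL (Fin n) K} {Y : GL (Fin n) E}
    (hY : (Y : Matrix (Fin n) (Fin n) E).map σ =
      (A : Matrix (Fin n) (Fin n) K).map (algebraMap K E) * Y)
    {R : Subalgebra K E} (hYR : adjoinEntries K (Y : Matrix (Fin n) (Fin n) E) = R)
    (hσR : ∀ x ∈ R, σ x ∈ R) {m : ℕ} {e : Fin (m + 1) → E} (h : IsSeparatedAlong e R)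
    (hσe : ∀ c, σ (e c) = e (c + 1)) :
    IsPicardVessiotExtension σK
      (σ.restrict (fractions R) (fractions R) (map_mem_fractions hσR)) A where
  commutes a := Subtype.ext (hσ a)
  pseudoField := h.isPseudoField_fractions hσR hσe
  generated := by
    let N : Matrix (Fin n) (Fin n) (fractions R) :=
      Matrix.of fun i j => ⟨Y i j, le_fractions R (hYR ▸ entry_mem_adjoinEntries i j)⟩
    have hNY : N.map (fractions R).val = Y := rfl
    have hN : IsUnit N.det := by
      rw [← isUnit_coe_fractions]
      have hdet := (Matrix.isUnit_iff_isUnit_det _).1 Y.isUnit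
      rwa [← hNY, ← AlgHom.mapMatrix_apply, ← AlgHom.map_det] at hdet
    refine ⟨Matrix.nonsingInvUnit N hN, ?_, h.isFractionRing_fractions ?_⟩
    · refine Matrix.map_injective (f := (fractions R).val.toRingHom) Subtype.val_injective ?_
      exact hY.trans <| (Matrix.map_mul (f := (fractions R).val.toRingHom)
        (L := (A : Matrix (Fin n) (Fin n) K).map (algebraMap K (fractions R))) (M := N)).symm
    · rw [AlgHom.map_adjoin, ← Set.range_comp]
      exact hYR
  constants x := by
    refine ⟨fun hx => ?_, ?_⟩
    · obtain ⟨c, hc, hcx⟩ := hconst x (congrArg Subtype.val hx)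
      exact ⟨c, hc, Subtype.ext hcx⟩
    · rintro ⟨c, hc, rfl⟩
      exact Subtype.ext ((hσ c).trans (congrArg _ hc))

section CyclicIdempotents

variable {K E : Type*} [CommRing K] [CommRing E] [Algebra K E] {σ : E →+* E} {l : ℕ}
  {e : ZMod l → E} (hσe : ∀ c, σ (e c) = e (c + 1))
include hσe

theorem iterate_map_of_map_eq_add_one (n : ℕ) (c : ZMod l) : σ^[n] (e c) = e (c + n) := by
  induction n with
  | zero => simp
  | succ n ih => rw [Function.iterate_succ_apply', ih, hσe, Nat.cast_succ, add_assoc]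

theorem iterate_mul_eq_zero_iff (hinj : Function.Injective σ) (x : E) (n : ℕ) (c : ZMod l) :
    σ^[n] x * e (c + n) = 0 ↔ x * e c = 0 := by
  rw [← iterate_map_of_map_eq_add_one hσe, ← iterate_map_mul, ← iterate_map_zero σ n,
    (hinj.iterate n).eq_iff, iterate_map_zero]

variable [NeZero l]

theorem dvd_iterate_and_iterate_dvd (he : ∑ c, e c = 1) {x : E}
    (hx : ∀ c, x * e c = 0 ∨ x ∣ e c) {n : ℕ} (hn : l ∣ n) : x ∣ σ^[n] x ∧ σ^[n] x ∣ x := by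
  have hσn (c : ZMod l) : σ^[n] (e c) = e c := by
    rw [iterate_map_of_map_eq_add_one hσe, (ZMod.natCast_eq_zero_iff n l).2 hn, add_zero]
  constructor <;> refine dvd_of_forall_dvd_mul he fun c => ?_ <;> obtain hxc | ⟨y, hxc⟩ := hx c
  · rw [← hσn c, ← iterate_map_mul, hxc, iterate_map_zero]
    exact dvd_zero x
  · exact (Dvd.intro y hxc.symm).mul_left _
  · exact hxc ▸ dvd_zero _
  · rw [← hσn c, hxc, iterate_map_mul]
    exact (dvd_mul_right _ _).mul_left x

variable (hinj : Function.Injective σ) {R : Subalgebra K E} (hσR : ∀ x ∈ R, σ x ∈ R)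
  (hdvd : ∀ x ∈ R, ∀ c, x * e c = 0 ∨ x ∣ e c)
include hinj hσR hdvd

theorem dvd_iterate_of_not_separating (he : ∑ c, e c = 1) {c d : ZMod l}
    (hcd : ∀ x ∈ R, x * e c = 0 → x * e d = 0) {x : E} (hx : x ∈ R) :
    x ∣ σ^[(c - d).val] x := by
  have vanish (a : ZMod l) (hxa : x * e a = 0) : x * e (a + (d - c)) = 0 := by
    have hmem : σ^[(c - a).val] x ∈ R := (show Set.MapsTo σ R R from hσR).iterate _ hx
    rw [← iterate_mul_eq_zero_iff hσe hinj x (c - a).val, ZMod.natCast_zmod_val] at hxa ⊢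
    rw [show a + (d - c) + (c - a) = d by ring]
    exact hcd _ hmem (by rwa [add_sub_cancel] at hxa)
  refine dvd_of_forall_dvd_mul he fun a => ?_
  obtain hxa | hxa := hdvd x hx a
  · have h0 := (iterate_mul_eq_zero_iff hσe hinj x (c - d).val _).2 (vanish a hxa)
    rw [ZMod.natCast_zmod_val, add_assoc, sub_add_sub_cancel', sub_self, add_zero] at h0
    exact h0 ▸ dvd_zero x
  · exact hxa.mul_left _

theorem isSeparatedAlong_of_minimal (he : CompleteOrthogonalIdempotents e) (hne : ∀ c, e c ≠ 0)
    (hmin : ∀ s, 0 < s → s < l → ∃ x ∈ R, ¬(x ∣ σ^[s] x ∧ σ^[s] x ∣ x)) :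
    IsSeparatedAlong e R := by
  refine ⟨he, hne, hdvd, fun c d hcd => ?_⟩
  -- If the classes `c` and `d` are not separated, then `c - d` is a smaller common period.
  by_contra! hsep
  have dvd_iterate (x : E) (hx : x ∈ R) : x ∣ σ^[(c - d).val] x :=
    dvd_iterate_of_not_separating hσe hinj hσR hdvd he.complete hsep hx
  have dvd_iterate_mul (x : E) (hx : x ∈ R) (n : ℕ) : x ∣ σ^[(c - d).val * n] x := by
    induction n with
    | zero => simp
    | succ n ih =>
      rw [Nat.mul_succ, add_comm, Function.iterate_add_apply]
      exact ih.trans (dvd_iterate _ ((show Set.MapsTo σ R R from hσR).iterate _ hx))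
  obtain ⟨x, hx, hns⟩ := hmin (c - d).val (ZMod.val_pos.2 (sub_ne_zero.2 hcd)) (ZMod.val_lt _)
  refine hns ⟨dvd_iterate x hx, ?_⟩
  obtain ⟨n, hn⟩ := Nat.exists_eq_succ_of_ne_zero (NeZero.ne l)
  calc σ^[(c - d).val] x ∣ σ^[(c - d).val * n] (σ^[(c - d).val] x) :=
        dvd_iterate_mul _ ((show Set.MapsTo σ R R from hσR).iterate _ hx) n
    _ = σ^[(c - d).val * l] x := by
        rw [← Function.iterate_add_apply, ← Nat.mul_succ, ← hn]
    _ ∣ x := (dvd_iterate_and_iterate_dvd hσe he.complete (hdvd x hx) (dvd_mul_left _ _)).2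

end CyclicIdempotents

theorem IsPseudoField.exists_dvd_iterate {L : Type*} [CommRing L] {σ : L →+* L}
    (h : IsPseudoField σ) : ∃ l > 0, ∀ x, x ∣ σ^[l] x ∧ σ^[l] x ∣ x := by
  obtain ⟨m, e, he, hσe, hinv⟩ := h
  refine ⟨m + 1, m.succ_pos, fun x => ?_⟩
  refine dvd_iterate_and_iterate_dvd (e := fun c : ZMod (m + 1) => e c) hσe he.complete
    (fun c => or_iff_not_imp_left.2 fun hxc => ?_) dvd_rfl
  obtain ⟨y, hy⟩ := (hinv c).2 x (mul_comm x _ ▸ hxc)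
  exact ⟨e c * (e c * y), by linear_combination -hy⟩

end PicardVessiot

/-! ### Zeros of sequences -/

section Sequences

variable {k : Type*} [Field k]

theorem Seq.mk_mul (f g : ℕ → k) : Seq.mk f * Seq.mk g = Seq.mk fun i => f i * g i := rfl

theorem Seq.mk_add (f g : ℕ → k) : Seq.mk f + Seq.mk g = Seq.mk fun i => f i + g i := rfl

theorem Seq.mk_zero : Seq.mk (fun _ => (0 : k)) = 0 := rfl

theorem Seq.mk_one : Seq.mk (fun _ => (1 : k)) = 1 := rfl

theorem Seq.mk_sum {ι : Type*} (s : Finset ι) (f : ι → ℕ → k) :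
    ∑ j ∈ s, Seq.mk (f j) = Seq.mk fun i => ∑ j ∈ s, f j i := by
  classical
  induction s using Finset.induction_on with
  | empty => rfl
  | insert j s hj ih => simp only [Finset.sum_insert hj, ih, Seq.mk_add]

theorem Seq.mk_eq_zero {f : ℕ → k} : Seq.mk f = 0 ↔ ∀ᶠ i in atTop, f i = 0 := Seq.mk_eq_mk

theorem Seq.mk_dvd_mk {f g : ℕ → k} :
    Seq.mk f ∣ Seq.mk g ↔ ∀ᶠ i in atTop, f i = 0 → g i = 0 := by
  refine ⟨fun ⟨y, hy⟩ => ?_, fun h => ⟨Seq.mk fun i => g i / f i, Seq.mk_eq_mk.2 ?_⟩⟩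
  · obtain ⟨u, rfl⟩ := y.exists_mk
    filter_upwards [Seq.mk_eq_mk.1 hy] with i hi hf
    rw [hi, hf, zero_mul]
  · filter_upwards [h] with i hi
    exact (mul_div_cancel_of_imp' hi).symm

theorem shiftSeq_iterate_mk (f : ℕ → k) (n : ℕ) :
    (shiftSeq k)^[n] (Seq.mk f) = Seq.mk fun i => f (i + n) := by
  induction n generalizing f with
  | zero => rfl
  | succ n ih => simp only [Function.iterate_succ_apply, shiftSeq_mk, ih, add_assoc]

theorem shiftSeq_bijective : Function.Bijective (shiftSeq k) := by
  refine ⟨(injective_iff_map_eq_zero _).2 fun x hx => ?_, fun x => ?_⟩ <;>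
    obtain ⟨f, rfl⟩ := x.exists_mk
  · rwa [shiftSeq_mk, Seq.mk_eq_zero, ← eventually_map (P := fun i => f i = 0),
      map_add_atTop_eq_nat, ← Seq.mk_eq_zero] at hx
  · exact ⟨Seq.mk fun i => f (i - 1), rfl⟩

theorem shiftSeq_iterate_dvd_iff (n : ℕ) {x y : Seq k} :
    (shiftSeq k)^[n] x ∣ (shiftSeq k)^[n] y ↔ x ∣ y := by
  induction n with
  | zero => rfl
  | succ n ih =>
    rw [Function.iterate_succ_apply', Function.iterate_succ_apply', ← ih]
    exact map_dvd_iff (RingEquiv.ofBijective (shiftSeq k) shiftSeq_bijective)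

theorem exists_eq_mk_const_of_shiftSeq_eq {x : Seq k} (hx : shiftSeq k x = x) :
    ∃ c : k, x = Seq.mk fun _ => c := by
  obtain ⟨f, rfl⟩ := x.exists_mk
  rw [shiftSeq_mk, Seq.mk_eq_mk] at hx
  obtain ⟨N, hN⟩ := eventually_atTop.1 hx
  refine ⟨f N, Seq.mk_eq_mk.2 (eventually_atTop.2 ⟨N, fun i hi => ?_⟩)⟩
  induction i, hi using Nat.le_induction with
  | base => rfl
  | succ i hi ih => rw [hN i hi, ih]

/-- The zero set of the sequence `x` is eventually periodic; this is expressed by divisibility, as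
`x ∣ y` holds if and only if the zeros of `x` are eventually zeros of `y`. -/
def Seq.PeriodicZeros (x : Seq k) : Prop :=
  ∃ l > 0, x ∣ (shiftSeq k)^[l] x ∧ (shiftSeq k)^[l] x ∣ x

theorem dvd_iterate_mk_iff {f : ℕ → k} {l : ℕ} :
    (Seq.mk f ∣ (shiftSeq k)^[l] (Seq.mk f) ∧ (shiftSeq k)^[l] (Seq.mk f) ∣ Seq.mk f) ↔
      ∀ᶠ i in atTop, f i = 0 ↔ f (i + l) = 0 := by
  simp only [shiftSeq_iterate_mk, Seq.mk_dvd_mk, ← eventually_and, iff_def]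

theorem Seq.periodicZeros_mk_iff {f : ℕ → k} :
    (Seq.mk f).PeriodicZeros ↔ IsFiniteUnionAP {i | f i = 0} := by
  simp only [Seq.PeriodicZeros, dvd_iterate_mk_iff, isFiniteUnionAP_iff, Set.mem_ofPred_eq]

variable (k) in
/-- The characteristic sequence of the residue class `-c` modulo `l`; the sign makes `σ` translate
`c` by `1`. -/
def residueIndicator (l : ℕ) (c : ZMod l) : Seq k :=
  Seq.mk fun i => if (i : ZMod l) + c = 0 then 1 else 0

theorem mk_mul_residueIndicator {l : ℕ} {c : ZMod l} {f : ℕ → k} :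
    Seq.mk f * residueIndicator k l c = 0 ↔ ∀ᶠ i : ℕ in atTop, (i : ZMod l) + c = 0 → f i = 0 := by
  simp [residueIndicator, Seq.mk_mul, Seq.mk_eq_zero]

theorem mk_dvd_residueIndicator {l : ℕ} {c : ZMod l} {f : ℕ → k} :
    Seq.mk f ∣ residueIndicator k l c ↔ ∀ᶠ i : ℕ in atTop, f i = 0 → (i : ZMod l) + c ≠ 0 := by
  simp [residueIndicator, Seq.mk_dvd_mk]

theorem shiftSeq_residueIndicator (l : ℕ) (c : ZMod l) :
    shiftSeq k (residueIndicator k l c) = residueIndicator k l (c + 1) := by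
  simp only [residueIndicator, shiftSeq_mk, Nat.cast_add, Nat.cast_one, add_assoc, add_comm c]

theorem residueIndicator_ne_zero {l : ℕ} [NeZero l] (c : ZMod l) : residueIndicator k l c ≠ 0 := by
  rw [Ne, residueIndicator, Seq.mk_eq_zero, not_eventually, frequently_atTop]
  intro N
  refine ⟨l * N + (-c).val, ?_, by simp⟩
  exact (Nat.le_mul_of_pos_left N (NeZero.pos l)).trans (Nat.le_add_right _ _)

theorem completeOrthogonalIdempotents_residueIndicator (l : ℕ) [NeZero l] :
    CompleteOrthogonalIdempotents (residueIndicator k l) := by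
  refine ⟨⟨fun c => ?_, fun c d hcd => ?_⟩, ?_⟩
  · exact Seq.mk_eq_mk.2 (Eventually.of_forall fun i => by
      by_cases h : (i : ZMod l) + c = 0 <;> simp [h])
  · refine mk_mul_residueIndicator.2 (Eventually.of_forall fun i hd => if_neg fun hc => hcd ?_)
    exact add_left_cancel (hc.trans hd.symm)
  · simp [residueIndicator, Seq.mk_sum, add_eq_zero_iff_neg_eq, Seq.mk_one]

theorem residueIndicator_dvd_residueIndicator {l m : ℕ} (h : l ∣ m) (d : ZMod m) :
    residueIndicator k l (ZMod.castHom h _ d) ∣ residueIndicator k m d := by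
  refine mk_dvd_residueIndicator.2 (Eventually.of_forall fun i hi hd => ?_)
  have hid := congrArg (ZMod.castHom h (ZMod l)) hd
  rw [map_add, map_natCast, map_zero] at hid
  exact one_ne_zero ((if_pos hid).symm.trans hi)

theorem dvd_residueIndicator_of_forall {l m : ℕ} [NeZero m] (h : l ∣ m) {c : ZMod l} {x : Seq k}
    (hx : ∀ d : ZMod m, ZMod.castHom h _ d = c → x ∣ residueIndicator k m d) :
    x ∣ residueIndicator k l c := by
  refine dvd_of_forall_dvd_mul (completeOrthogonalIdempotents_residueIndicator m).complete
    fun d => ?_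
  by_cases hd : ZMod.castHom h (ZMod l) d = c
  · exact (hx d hd).mul_left _
  · convert dvd_zero x
    refine mk_mul_residueIndicator.2 (Eventually.of_forall fun i hid => if_neg fun hc => hd ?_)
    have := congrArg (ZMod.castHom h (ZMod l)) hid
    simp only [map_add, map_natCast, map_zero] at this
    exact add_left_cancel (this.trans hc.symm)

theorem mul_residueIndicator_eq_zero_or_dvd {l : ℕ} {x : Seq k}
    (hx : x ∣ (shiftSeq k)^[l] x ∧ (shiftSeq k)^[l] x ∣ x) (c : ZMod l) :
    x * residueIndicator k l c = 0 ∨ x ∣ residueIndicator k l c := by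
  obtain ⟨f, rfl⟩ := x.exists_mk
  obtain ⟨N, hN⟩ := eventually_atTop.1 (dvd_iterate_mk_iff.1 hx)
  have hadd (i n : ℕ) (hi : N ≤ i) : f i = 0 ↔ f (i + n * l) = 0 := by
    induction n with
    | zero => simp
    | succ n ih => rw [ih, hN _ (hi.trans (Nat.le_add_right _ _)), Nat.succ_mul, add_assoc]
  have hmod (i j : ℕ) (hi : N ≤ i) (hj : N ≤ j) (hij : (i : ZMod l) = j) (h0 : f i = 0) :
      f j = 0 := by
    rw [ZMod.natCast_eq_natCast_iff] at hij
    obtain h | h := le_total i j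
    · obtain ⟨n, hn⟩ := (Nat.modEq_iff_dvd' h).1 hij
      rwa [show j = i + n * l by lia, ← hadd i n hi]
    · obtain ⟨n, hn⟩ := (Nat.modEq_iff_dvd' h).1 hij.symm
      rwa [show i = j + n * l by lia, ← hadd j n hj] at h0
  refine or_iff_not_imp_right.2 fun hdvd => mk_mul_residueIndicator.2 ?_
  rw [mk_dvd_residueIndicator, not_eventually, frequently_atTop] at hdvd
  obtain ⟨i, hi, hic⟩ := hdvd N
  push Not at hic
  filter_upwards [eventually_ge_atTop N] with j hj hjc
  exact hmod i j hi hj (add_right_cancel (hic.2.trans hjc.symm)) hic.1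

theorem exists_annihilator_maximal {K : Type*} [CommRing K] [Algebra K (Seq k)]
    (R : Subalgebra K (Seq k)) [IsNoetherianRing R] : ∃ (l : ℕ) (c : ZMod l), 0 < l ∧
    ∀ m > 0, ∀ (h : l ∣ m) (d : ZMod m), ZMod.castHom h _ d = c →
      ∀ x ∈ R, x * residueIndicator k m d = 0 → x * residueIndicator k l c = 0 := by
  let ann (p : Σ l, ZMod l) : Ideal R := Ideal.torsionOf R (Seq k) (residueIndicator k p.1 p.2)
  obtain ⟨_, ⟨⟨l, c⟩, hl, rfl⟩, hmax⟩ := set_has_maximal_iff_noetherian.2 ‹IsNoetherian R R›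
    (ann '' {p | 0 < p.1}) ⟨_, ⟨1, 0⟩, Nat.one_pos, rfl⟩
  refine ⟨l, c, hl, fun m hm h d hdc x hx hxd => ?_⟩
  have hle : ann ⟨l, c⟩ ≤ ann ⟨m, d⟩ := fun y hy => by
    obtain ⟨z, hz⟩ := residueIndicator_dvd_residueIndicator (k := k) h d
    rw [hdc] at hz
    rw [Ideal.mem_torsionOf_iff] at hy ⊢
    rw [hz, ← smul_mul_assoc, hy, zero_mul]
  have heq := hle.eq_of_not_lt (hmax _ ⟨⟨m, d⟩, hm, rfl⟩)
  have hxd' : ⟨x, hx⟩ ∈ ann ⟨m, d⟩ := hxd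
  rwa [← heq] at hxd'

variable {K : Type*} [CommRing K] [Algebra K (Seq k)] {R : Subalgebra K (Seq k)}
  [IsNoetherianRing R] (hσR : ∀ x ∈ R, shiftSeq k x ∈ R) (hper : ∀ x ∈ R, x.PeriodicZeros)
include hper

theorem exists_mul_residueIndicator_eq_zero_or_dvd : ∃ (l : ℕ) (c : ZMod l), 0 < l ∧
    ∀ x ∈ R, x * residueIndicator k l c = 0 ∨ x ∣ residueIndicator k l c := by
  obtain ⟨l, c, hl, hmax⟩ := exists_annihilator_maximal R
  refine ⟨l, c, hl, fun x hx => or_iff_not_imp_left.2 fun hxc => ?_⟩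
  obtain ⟨m, hm, hxm⟩ := hper x hx
  have : NeZero (l * m) := ⟨(Nat.mul_pos hl hm).ne'⟩
  refine dvd_residueIndicator_of_forall (dvd_mul_right l m) fun d hd => ?_
  have hdvd := residueIndicator_dvd_residueIndicator (k := k) (dvd_mul_left m l) d
  refine (mul_residueIndicator_eq_zero_or_dvd hxm _).elim (fun h0 => absurd ?_ hxc) (·.trans hdvd)
  refine hmax _ (Nat.mul_pos hl hm) (dvd_mul_right l m) d hd x hx (zero_dvd_iff.1 ?_)
  exact h0 ▸ mul_dvd_mul_left x hdvd

include hσR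

theorem exists_uniform_period :
    ∃ l > 0, ∀ x ∈ R, x ∣ (shiftSeq k)^[l] x ∧ (shiftSeq k)^[l] x ∣ x := by
  obtain ⟨l, c, hl, hc⟩ := exists_mul_residueIndicator_eq_zero_or_dvd hper
  have : NeZero l := ⟨hl.ne'⟩
  refine ⟨l, hl, fun x hx => dvd_iterate_and_iterate_dvd (shiftSeq_residueIndicator l)
    (completeOrthogonalIdempotents_residueIndicator l).complete (fun d => ?_) dvd_rfl⟩
  have hdc : d + ((c - d).val : ZMod l) = c := by rw [ZMod.natCast_zmod_val, add_sub_cancel]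
  have hmem := (show Set.MapsTo (shiftSeq k) R R from hσR).iterate (c - d).val hx
  refine (hc _ hmem).imp (fun h0 => ?_) fun hdvd => ?_
  · rwa [← iterate_mul_eq_zero_iff (shiftSeq_residueIndicator l) shiftSeq_bijective.1 x
      (c - d).val, hdc]
  · rwa [← shiftSeq_iterate_dvd_iff (c - d).val,
      iterate_map_of_map_eq_add_one (shiftSeq_residueIndicator l), hdc]

theorem exists_isSeparatedAlong_residueIndicator :
    ∃ m, IsSeparatedAlong (residueIndicator k (m + 1)) R := by
  classical
  have hex := exists_uniform_period hσR hper
  obtain ⟨m, hm⟩ := Nat.exists_eq_succ_of_ne_zero (Nat.find_spec hex).1.ne'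
  have hspec := (Nat.find_spec hex).2
  have hmin := @Nat.find_min _ _ hex
  rw [hm] at hspec hmin
  refine ⟨m, isSeparatedAlong_of_minimal (shiftSeq_residueIndicator _) shiftSeq_bijective.1 hσR
    (fun x hx => mul_residueIndicator_eq_zero_or_dvd (hspec x hx))
    (completeOrthogonalIdempotents_residueIndicator _) residueIndicator_ne_zero fun s hs hsm => ?_⟩
  have := hmin hsm
  push Not at this
  simpa [hs] using this

end Sequences

/-! ### Rational functions as sequences -/

section RationalFunctions

variable {k : Type*} [Field k]

/-- The endomorphism `h(z) ↦ h(z + b)` of `k(z)`. -/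
def translate (b : k) : RatFunc k →+* RatFunc k :=
  RatFunc.mapRingHom (Polynomial.taylorAlgHom b).toRingHom
    (nonZeroDivisors_le_comap_nonZeroDivisors_of_injective _ (Polynomial.taylor_injective b))

theorem translate_one : translate (1 : k) = shiftRatFunc k := rfl

theorem translate_algebraMap (b : k) (p : Polynomial k) :
    translate b (algebraMap _ _ p) = algebraMap _ _ (Polynomial.taylor b p) := by
  have hdiv := RatFunc.map_apply_div (φ := (Polynomial.taylorAlgHom b).toRingHom)
    (nonZeroDivisors_le_comap_nonZeroDivisors_of_injective _ (Polynomial.taylor_injective b)) p 1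
  simp only [map_one, div_one] at hdiv
  exact hdiv

theorem shiftRatFunc_surjective : Function.Surjective (shiftRatFunc k) := fun h =>
  ⟨algebraMap _ _ (Polynomial.taylor (-1) h.num) / algebraMap _ _ (Polynomial.taylor (-1) h.denom),
    by simp [← translate_one, translate_algebraMap, Polynomial.taylor_taylor,
      RatFunc.num_div_denom]⟩

theorem value_eq_div (h : RatFunc k) (a : k) : value h a = h.num.eval a / h.denom.eval a := by
  simp [value, RatFunc.eval, Polynomial.eval₂_id]

theorem value_algebraMap (p : Polynomial k) (a : k) :
    value (algebraMap _ (RatFunc k) p) a = p.eval a := by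
  simp [value, RatFunc.eval_algebraMap, Polynomial.eval₂_id]

variable [CharZero k]

theorem eventually_eval_add_ne_zero {p : Polynomial k} (hp : p ≠ 0) (b : k) :
    ∀ᶠ i : ℕ in atTop, p.eval (i + b) ≠ 0 := by
  have hfin : {i : ℕ | p.eval (i + b) = 0}.Finite :=
    (Polynomial.finite_setOfPred_isRoot hp).preimage
      (f := fun i : ℕ => (i + b : k)) (fun i _ j _ h => by simpa using h)
  simpa [Nat.cofinite_eq_atTop] using hfin.eventually_cofinite_notMem

theorem algebraMap_eq_mk (h : RatFunc k) :
    algebraMap (RatFunc k) (Seq k) h = Seq.mk fun i => value h i := rfl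

theorem algebraMap_translate (b : k) (h : RatFunc k) :
    algebraMap (RatFunc k) (Seq k) (translate b h) = Seq.mk fun i => value h (i + b) := by
  have hmul : translate b h * algebraMap _ _ (Polynomial.taylor b h.denom) =
      algebraMap _ _ (Polynomial.taylor b h.num) := by
    have hd : algebraMap (Polynomial k) (RatFunc k) h.denom ≠ 0 := by simp [h.denom_ne_zero]
    rw [← translate_algebraMap, ← translate_algebraMap, ← map_mul, ← (eq_div_iff hd).1
      h.num_div_denom.symm]
  have hseq := congrArg (algebraMap (RatFunc k) (Seq k)) hmul
  rw [map_mul, algebraMap_eq_mk, algebraMap_eq_mk, algebraMap_eq_mk, Seq.mk_mul,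
    Seq.mk_eq_mk] at hseq
  refine Seq.mk_eq_mk.2 ?_
  filter_upwards [hseq, eventually_eval_add_ne_zero h.denom_ne_zero b] with i hi hne
  rw [value_algebraMap, value_algebraMap, Polynomial.taylor_eval, Polynomial.taylor_eval] at hi
  rw [value_eq_div h, eq_div_iff hne, hi]

theorem shiftSeq_algebraMap (h : RatFunc k) :
    shiftSeq k (algebraMap (RatFunc k) (Seq k) h) = algebraMap _ _ (shiftRatFunc k h) := by
  rw [← translate_one, algebraMap_translate, algebraMap_eq_mk, shiftSeq_mk]
  simp only [Nat.cast_succ]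

theorem algebraMap_C (c : k) :
    algebraMap (RatFunc k) (Seq k) (RatFunc.C c) = Seq.mk fun _ => c := by
  simp [algebraMap_eq_mk, value]

theorem exists_algebraMap_eq_of_shiftSeq_eq {x : Seq k} (hx : shiftSeq k x = x) :
    ∃ h, shiftRatFunc k h = h ∧ algebraMap (RatFunc k) (Seq k) h = x := by
  obtain ⟨c, rfl⟩ := exists_eq_mk_const_of_shiftSeq_eq hx
  refine ⟨RatFunc.C c, ?_, algebraMap_C c⟩
  rw [← translate_one, ← RatFunc.algebraMap_C, translate_algebraMap, Polynomial.taylor_C]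

variable (k) in
/-- The ring of sequences that satisfy a linear recurrence with coefficients in `k(z)`. -/
abbrev recurrentSeq : Subalgebra (RatFunc k) (Seq k) := recurrent (shiftSeq_algebraMap (k := k))

theorem isSolution_iff {n : ℕ} {h : Fin n → RatFunc k} {f : ℕ → k} :
    IsSolution h f ↔
      (shiftSeq k)^[n] (Seq.mk f) + ∑ j, h j • (shiftSeq k)^[j] (Seq.mk f) = 0 := by
  simp only [shiftSeq_iterate_mk, Algebra.smul_def, algebraMap_eq_mk, Seq.mk_mul, Seq.mk_sum,
    Seq.mk_add, Seq.mk_eq_zero]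
  rfl

theorem mk_mem_recurrentSeq_iff {f : ℕ → k} :
    Seq.mk f ∈ recurrentSeq k ↔ ∃ (n : ℕ) (h : Fin n → RatFunc k), IsSolution h f := by
  simp only [isSolution_iff, mem_recurrent_iff]

theorem forall_isSolution_isFiniteUnionAP_iff :
    (∀ (n : ℕ) (h : Fin n → RatFunc k) (f : ℕ → k), IsSolution h f →
      IsFiniteUnionAP {i : ℕ | f i = 0}) ↔ ∀ x ∈ recurrentSeq k, x.PeriodicZeros := by
  refine ⟨fun hsol x hx => ?_, fun hper n h f hf => ?_⟩
  · obtain ⟨f, rfl⟩ := x.exists_mk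
    obtain ⟨n, h, hf⟩ := mk_mem_recurrentSeq_iff.1 hx
    exact Seq.periodicZeros_mk_iff.2 (hsol n h f hf)
  · exact Seq.periodicZeros_mk_iff.1 (hper _ (mk_mem_recurrentSeq_iff.2 ⟨n, h, hf⟩))

end RationalFunctions

/-! ### Sequences of matrices -/

section Matrices

variable {k ι κ : Type*}

/-- The matrix over the ring of sequences given by a sequence of matrices. -/
def Seq.mkMatrix (M : ℕ → Matrix ι κ k) : Matrix ι κ (Seq k) :=
  Matrix.of fun r s => Seq.mk fun i => M i r s

theorem Seq.mkMatrix_eq_mkMatrix [Finite ι] [Finite κ] {M N : ℕ → Matrix ι κ k} :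
    Seq.mkMatrix M = Seq.mkMatrix N ↔ ∀ᶠ i in atTop, M i = N i := by
  simp only [← Matrix.ext_iff, eventually_all, Seq.mkMatrix, Matrix.of_apply, Seq.mk_eq_mk]

variable [Field k]

theorem Seq.mkMatrix_mul_mkMatrix [Fintype ι] (M N : ℕ → Matrix ι ι k) :
    Seq.mkMatrix M * Seq.mkMatrix N = Seq.mkMatrix fun i => M i * N i := by
  ext r s
  simp only [Seq.mkMatrix, Matrix.mul_apply, Matrix.of_apply, Seq.mk_mul, Seq.mk_sum]

theorem Seq.mkMatrix_one [DecidableEq ι] : Seq.mkMatrix (fun _ => (1 : Matrix ι ι k)) = 1 := by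
  ext r s
  obtain rfl | h := eq_or_ne r s
  · simp [Seq.mkMatrix, Seq.mk_one]
  · simp [Seq.mkMatrix, Seq.mk_zero, h]

theorem map_shiftSeq_mkMatrix (M : ℕ → Matrix ι κ k) :
    (Seq.mkMatrix M).map (shiftSeq k) = Seq.mkMatrix fun i => M (i + 1) := rfl

variable [CharZero k] {n : ℕ}

theorem map_algebraMap_translate (A : GL (Fin n) (RatFunc k)) (b : k) :
    ((A : Matrix (Fin n) (Fin n) (RatFunc k)).map (translate b)).map
      (algebraMap (RatFunc k) (Seq k)) = Seq.mkMatrix fun i => valueMatrix A (i + b) := by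
  ext r s
  exact algebraMap_translate b _

theorem map_algebraMap_eq_mkMatrix (A : GL (Fin n) (RatFunc k)) :
    (A : Matrix (Fin n) (Fin n) (RatFunc k)).map (algebraMap (RatFunc k) (Seq k)) =
      Seq.mkMatrix fun i => valueMatrix A i := rfl

theorem eventually_det_valueMatrix_ne_zero (A : GL (Fin n) (RatFunc k)) :
    ∀ᶠ i : ℕ in atTop, (valueMatrix A (i : k)).det ≠ 0 := by
  have hinv := congrArg (fun M => M.map (algebraMap (RatFunc k) (Seq k))) A.mul_inv
  rw [Matrix.map_mul, Matrix.map_one _ (map_zero _) (map_one _), map_algebraMap_eq_mkMatrix,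
    map_algebraMap_eq_mkMatrix, ← Seq.mkMatrix_one, Seq.mkMatrix_mul_mkMatrix,
    Seq.mkMatrix_eq_mkMatrix] at hinv
  filter_upwards [hinv] with i hi
  exact Matrix.det_ne_zero_of_right_inverse hi

theorem exists_fundamentalMatrix (A : GL (Fin n) (RatFunc k)) :
    ∃ Y : GL (Fin n) (Seq k), (Y : Matrix (Fin n) (Fin n) (Seq k)).map (shiftSeq k) =
      (A : Matrix (Fin n) (Fin n) (RatFunc k)).map (algebraMap (RatFunc k) (Seq k)) * Y := by
  classical
  let B (i : ℕ) : GL (Fin n) k :=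
    if h : (valueMatrix A (i : k)).det ≠ 0 then .mkOfDetNeZero _ h else 1
  have hB : ∀ᶠ i : ℕ in atTop, (B i : Matrix (Fin n) (Fin n) k) = valueMatrix A i := by
    filter_upwards [eventually_det_valueMatrix_ne_zero A] with i hi
    simp only [B, dif_pos hi]
    rfl
  let P (i : ℕ) : GL (Fin n) k := Nat.rec 1 (fun j Q => B j * Q) i
  refine ⟨⟨Seq.mkMatrix fun i => (P i).val, Seq.mkMatrix fun i => (P i)⁻¹.val, ?_, ?_⟩, ?_⟩
  · simp only [Seq.mkMatrix_mul_mkMatrix, Units.mul_inv, Seq.mkMatrix_one]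
  · simp only [Seq.mkMatrix_mul_mkMatrix, Units.inv_mul, Seq.mkMatrix_one]
  · rw [map_shiftSeq_mkMatrix, map_algebraMap_eq_mkMatrix, Seq.mkMatrix_mul_mkMatrix,
      Seq.mkMatrix_eq_mkMatrix]
    filter_upwards [hB] with i hi
    rw [← hi, ← Units.val_mul]

theorem hasPVExtensionInSeq_of_periodicZeros (hper : ∀ x ∈ recurrentSeq k, x.PeriodicZeros)
    (A : GL (Fin n) (RatFunc k)) : HasPVExtensionInSeq A := by
  obtain ⟨Y, hY⟩ := exists_fundamentalMatrix A
  obtain ⟨m, hm⟩ := exists_isSeparatedAlong_residueIndicator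
    (map_mem_adjoinEntries shiftSeq_algebraMap hY)
    fun x hx => hper x (adjoinEntries_le_recurrent shiftSeq_algebraMap hY hx)
  exact ⟨_, _, IsSeparatedAlong.isPicardVessiotExtension_fractions shiftSeq_algebraMap
    (fun _ => exists_algebraMap_eq_of_shiftSeq_eq) hY rfl
    (map_mem_adjoinEntries shiftSeq_algebraMap hY) hm (shiftSeq_residueIndicator (m + 1))⟩

theorem periodicZeros_of_hasPVExtensionInSeq
    (hPV : ∀ (n : ℕ) (A : GL (Fin n) (RatFunc k)), HasPVExtensionInSeq A) {x : Seq k}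
    (hx : x ∈ recurrentSeq k) : x.PeriodicZeros := by
  obtain ⟨n, A, v, hv, i, rfl⟩ :=
    exists_system shiftSeq_algebraMap shiftRatFunc_surjective shiftSeq_bijective.1 hx
  obtain ⟨L, hL, hPV⟩ := hPV n A
  obtain ⟨Z, hZ, -⟩ := hPV.generated
  have hmem : v i ∈ L := by
    refine mem_of_map_eq_mulVec (σ := shiftSeq k) (L := L.toSubring)
      (B := A.map (algebraMap _ _)) (Z := Z.map L.val.toRingHom) ?_ (fun r s => (Z r s).2)
      (fun y hy => ?_) ?_ i
    · exact (congrArg (fun M => M.map L.val.toRingHom) hZ).trans Matrix.map_mul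
    · obtain ⟨h, -, rfl⟩ := exists_algebraMap_eq_of_shiftSeq_eq hy
      exact L.algebraMap_mem h
    · ext r
      simpa [Matrix.mulVec, dotProduct, Algebra.smul_def] using hv r
  obtain ⟨l, hl, hdvd⟩ := hPV.pseudoField.exists_dvd_iterate
  have hcoe : ((((shiftSeq k).restrict L L hL)^[l] ⟨v i, hmem⟩ : L) : Seq k) =
      (shiftSeq k)^[l] (v i) := Function.Semiconj.iterate_right (f := L.val)
        (ga := (shiftSeq k).restrict L L hL) (gb := shiftSeq k) (fun _ => rfl) l _
  exact ⟨l, hl, hcoe ▸ map_dvd L.val (hdvd _).1, hcoe ▸ map_dvd L.val (hdvd _).2⟩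

end Matrices

/-! ### The dynamics on `𝔸¹ × GLₙ` -/

section Orbits

variable {k : Type*} [Field k] {n : ℕ} {A : GL (Fin n) (RatFunc k)} {x : Pt k n}

theorem step_fst (hx : x ∈ stepDomain A) : (step A x).1 = x.1 + 1 := by
  rw [step, dif_pos hx]

theorem coe_step_snd (hx : x ∈ stepDomain A) :
    ((step A x).2 : Matrix (Fin n) (Fin n) k) = valueMatrix A x.1 * x.2 := by
  rw [step, dif_pos hx]
  rfl

theorem iterate_step_fst_of_forall_lt {i : ℕ} (hx : ∀ j < i, (step A)^[j] x ∈ stepDomain A) :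
    ((step A)^[i] x).1 = i + x.1 := by
  induction i with
  | zero => simp
  | succ i ih =>
    rw [Function.iterate_succ_apply', step_fst (hx i i.lt_succ_self),
      ih fun j hj => hx j (hj.trans i.lt_succ_self), Nat.cast_succ, add_right_comm]

theorem iterate_step_fst (hx : OrbitDefined A x) (i : ℕ) : ((step A)^[i] x).1 = i + x.1 :=
  iterate_step_fst_of_forall_lt fun j _ => hx j

theorem coe_iterate_succ_step_snd (hx : OrbitDefined A x) (i : ℕ) :
    (((step A)^[i + 1] x).2 : Matrix (Fin n) (Fin n) k) =
      valueMatrix A (i + x.1) * ((step A)^[i] x).2 := by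
  rw [Function.iterate_succ_apply', coe_step_snd (hx i), iterate_step_fst hx]

theorem orbitDefined_of_forall_natCast_add
    (hA : ∀ i : ℕ, (∀ r s, RegularAt (A r s) (i + x.1)) ∧ (valueMatrix A (i + x.1)).det ≠ 0) :
    OrbitDefined A x := by
  intro i
  induction i using Nat.strong_induction_on with
  | h i ih =>
    rw [stepDomain, Set.mem_ofPred_eq, iterate_step_fst_of_forall_lt ih]
    exact hA i

theorem eq_iterate_step_snd_mulVec (hx : OrbitDefined A x) (hx1 : x.2 = 1) {v : ℕ → Fin n → k}
    (hv : ∀ i : ℕ, v (i + 1) = (valueMatrix A (i + x.1)).mulVec (v i)) (i : ℕ) :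
    v i = (((step A)^[i] x).2 : Matrix (Fin n) (Fin n) k).mulVec (v 0) := by
  induction i with
  | zero => simp [hx1]
  | succ i ih => rw [hv, coe_iterate_succ_step_snd hx, ih, Matrix.mulVec_mulVec]

theorem IsClosedSubvariety.exists_finset {Y : Set (Pt k n)} (hY : IsClosedSubvariety Y) :
    ∃ T : Finset (MvPolynomial (Option (Fin n × Fin n)) k),
      Y = {x | ∀ p ∈ T, MvPolynomial.eval (coords x) p = 0} := by
  obtain ⟨S, rfl⟩ := hY
  obtain ⟨T, hTS, hT⟩ := (Submodule.fg_span_iff_fg_span_finset_subset S).1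
    (IsNoetherian.noetherian (Ideal.span S))
  refine ⟨T, Set.ext fun x => ⟨fun h p hp => h p (hTS hp), fun h p hp => ?_⟩⟩
  have hker : Ideal.span T ≤ RingHom.ker (MvPolynomial.eval (coords x)) := Ideal.span_le.2 h
  have hpT : p ∈ Ideal.span T := hT.le (Submodule.subset_span hp)
  exact hker hpT

theorem isClosedSubvariety_setOf_mulVec_eq_zero (r : Fin n) (v : Fin n → k) :
    IsClosedSubvariety {x : Pt k n | (x.2 : Matrix (Fin n) (Fin n) k).mulVec v r = 0} :=
  ⟨{∑ s, MvPolynomial.X (some (r, s)) * MvPolynomial.C (v s)}, by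
    simp [coords, Matrix.mulVec, dotProduct]⟩

variable [CharZero k]

theorem mk_iterate_step_fst_mem_recurrentSeq (hx : OrbitDefined A x) :
    Seq.mk (fun i => ((step A)^[i] x).1) ∈ recurrentSeq k := by
  convert Subalgebra.algebraMap_mem (recurrentSeq k)
    (algebraMap (Polynomial k) (RatFunc k) (Polynomial.X + Polynomial.C x.1)) using 1
  simp only [algebraMap_eq_mk, value_algebraMap, iterate_step_fst hx, Polynomial.eval_add,
    Polynomial.eval_X, Polynomial.eval_C]

theorem mk_iterate_step_snd_mem_recurrentSeq (hx : OrbitDefined A x) (r s : Fin n) :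
    Seq.mk (fun i => ((step A)^[i] x).2 r s) ∈ recurrentSeq k := by
  refine mem_recurrent_of_map_eq_mul shiftSeq_algebraMap
    (Y := Seq.mkMatrix fun i => ((step A)^[i] x).2.val) (A := A.val.map (translate x.1)) ?_ r s
  simp only [map_algebraMap_translate, map_shiftSeq_mkMatrix, Seq.mkMatrix_mul_mkMatrix,
    coe_iterate_succ_step_snd hx]

theorem mk_eval_iterate_step_mem_recurrentSeq (hx : OrbitDefined A x)
    (p : MvPolynomial (Option (Fin n × Fin n)) k) :
    Seq.mk (fun i => MvPolynomial.eval (coords ((step A)^[i] x)) p) ∈ recurrentSeq k := by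
  induction p using MvPolynomial.induction_on with
  | C a =>
    simp only [MvPolynomial.eval_C, ← algebraMap_C]
    exact Subalgebra.algebraMap_mem _ _
  | add p q hp hq =>
    simp only [map_add]
    exact add_mem hp hq
  | mul_X p c hp =>
    simp only [map_mul, MvPolynomial.eval_X]
    refine (recurrentSeq k).mul_mem hp (y := Seq.mk _) ?_
    rcases c with _ | ⟨r, s⟩
    · exact mk_iterate_step_fst_mem_recurrentSeq hx
    · exact mk_iterate_step_snd_mem_recurrentSeq hx r s

theorem isFiniteUnionAP_setOf_iterate_step_mem (hper : ∀ x ∈ recurrentSeq k, x.PeriodicZeros)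
    (hx : OrbitDefined A x) {Y : Set (Pt k n)} (hY : IsClosedSubvariety Y) :
    IsFiniteUnionAP {i : ℕ | (step A)^[i] x ∈ Y} := by
  obtain ⟨T, rfl⟩ := hY.exists_finset
  exact isFiniteUnionAP_setOf_forall_mem T
    (S := fun p => {i | MvPolynomial.eval (coords ((step A)^[i] x)) p = 0}) fun p _ =>
      Seq.periodicZeros_mk_iff.1 (hper _ (mk_eval_iterate_step_mem_recurrentSeq hx p))

theorem periodicZeros_of_isFiniteUnionAP_orbit
    (horbit : ∀ (n : ℕ) (A : GL (Fin n) (RatFunc k)) (Y : Set (Pt k n)), IsClosedSubvariety Y →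
      ∀ x : Pt k n, OrbitDefined A x → IsFiniteUnionAP {i : ℕ | (step A)^[i] x ∈ Y})
    {x : Seq k} (hx : x ∈ recurrentSeq k) : x.PeriodicZeros := by
  obtain ⟨n, A, v, hv, r, rfl⟩ :=
    exists_system shiftSeq_algebraMap shiftRatFunc_surjective shiftSeq_bijective.1 hx
  choose g hg using fun r => (v r).exists_mk
  obtain rfl : (fun r => Seq.mk (g r)) = v := funext hg
  have hrec : ∀ᶠ i : ℕ in atTop, (fun r => g r (i + 1)) = (valueMatrix A i).mulVec (g · i) := by
    simp only [funext_iff, eventually_all]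
    intro r
    have hr := hv r
    simp only [shiftSeq_mk, Algebra.smul_def, algebraMap_eq_mk, Seq.mk_mul, Seq.mk_sum] at hr
    exact Seq.mk_eq_mk.1 hr
  have hreg : ∀ᶠ i : ℕ in atTop, ∀ r s, RegularAt (A r s) (i : k) := by
    simp only [eventually_all]
    exact fun r s => eventually_regularAt _
  obtain ⟨N, hN⟩ := eventually_atTop.1
    (hreg.and ((eventually_det_valueMatrix_ne_zero A).and hrec))
  replace hN (i : ℕ) := hN (i + N) (Nat.le_add_left N i)
  push_cast at hN
  have horb : OrbitDefined A ((N, 1) : Pt k n) :=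
    orbitDefined_of_forall_natCast_add fun i => ⟨(hN i).1, (hN i).2.1⟩
  have hgN (i : ℕ) := congrFun (eq_iterate_step_snd_mulVec horb rfl
    (v := fun i r => g r (i + N)) (fun i => by simpa [add_right_comm] using (hN i).2.2) i) r
  simp only [zero_add] at hgN
  refine Seq.periodicZeros_mk_iff.2 (isFiniteUnionAP_of_add N ?_)
  simpa only [Set.mem_ofPred_eq, hgN] using
    horbit n A _ (isClosedSubvariety_setOf_mulVec_eq_zero r (g · N)) _ horb

end Orbits

end DifferenceEq

end

theorem mainTheorem2 (k : Type*) [Field k] [CharZero k] :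
    List.TFAE [
      ∀ (n : ℕ) (A : GL (Fin n) (RatFunc k)) (Y : Set (DifferenceEq.Pt k n)),
        DifferenceEq.IsClosedSubvariety Y →
        ∀ x : DifferenceEq.Pt k n, DifferenceEq.OrbitDefined A x →
          DifferenceEq.IsFiniteUnionAP {i : ℕ | (DifferenceEq.step A)^[i] x ∈ Y},
      ∀ (n : ℕ) (h : Fin n → RatFunc k) (f : ℕ → k), DifferenceEq.IsSolution h f →
        DifferenceEq.IsFiniteUnionAP {i : ℕ | f i = 0},
      ∀ (n : ℕ) (A : GL (Fin n) (RatFunc k)), DifferenceEq.HasPVExtensionInSeq A] := by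
  rw [DifferenceEq.forall_isSolution_isFiniteUnionAP_iff]
  tfae_have 1 → 2 := fun horbit _ => DifferenceEq.periodicZeros_of_isFiniteUnionAP_orbit horbit
  tfae_have 2 → 1 := fun hper _ _ _ hY _ hx =>
    DifferenceEq.isFiniteUnionAP_setOf_iterate_step_mem hper hx hY
  tfae_have 2 → 3 := fun hper _ => DifferenceEq.hasPVExtensionInSeq_of_periodicZeros hper
  tfae_have 3 → 2 := fun hPV _ => DifferenceEq.periodicZeros_of_hasPVExtensionInSeq hPV
  tfae_finish
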